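/- Let $\Bbbk$ be a field and let $A$ be a finite-dimensional unital associative $\Bbbk$-algebra that is self-injective, i.e. injective both as a left and as a right module over itself. Then there exists a $\Bbbk$-linear map $\Delta\colon A\to A\otimes_{\Bbbk}A$ which is injective, coassociative, i.e. $(\Delta\otimes\mathrm{id}_A)\circ\Delta=(\mathrm{id}_A\otimes\Delta)\circ\Delta$ as maps $A\to A\otimes_{\Bbbk}A\otimes_{\Bbbk}A$, and a morphism of $A$-bimodules, i.e. $\Delta(ab)=a\,\Delta(b)$ and $\Delta(ba)=\Delta(b)\,a$ for all $a,b\in A$, where $A\otimes_{\Bbbk}A$ carries the bimodule structure $a(x\otimes y)=(ax)\otimes y$ and $(x\otimes y)a=x\otimes(ya)$. -/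

import Mathlib

open scoped TensorProduct

/-- A ring `A` is self-injective if it is injective both as a left module and as a right module
over itself (right modules are left modules over the opposite ring). -/
def IsSelfInjective (A : Type*) [Ring A] : Prop :=
  Module.Injective A A ∧ Module.Injective Aᵐᵒᵖ A

/-- `Δ : A → A ⊗ A` is a morphism of `A`-bimodules, where `A ⊗ A` has the outer bimodule structure
`a • (x ⊗ y) = (a * x) ⊗ y` and `(x ⊗ y) • a = x ⊗ (y * a)`. -/
def IsBimoduleComul {K A : Type*} [Field K] [Ring A] [Algebra K A]
    (Δ : A →ₗ[K] A ⊗[K] A) : Prop :=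
  (∀ a b : A, Δ (a * b) = (LinearMap.mulLeft K a).rTensor A (Δ b)) ∧
    (∀ b a : A, Δ (b * a) = (LinearMap.mulRight K a).lTensor A (Δ b))

/-- Coassociativity of `Δ : A → A ⊗ A`: `(Δ ⊗ id) ∘ Δ = (id ⊗ Δ) ∘ Δ`, up to the canonical
isomorphism `(A ⊗ A) ⊗ A ≃ A ⊗ (A ⊗ A)`. -/
def IsCoassociative {K A : Type*} [Field K] [Ring A] [Algebra K A]
    (Δ : A →ₗ[K] A ⊗[K] A) : Prop :=
  (TensorProduct.assoc K A A A).toLinearMap ∘ₗ Δ.rTensor A ∘ₗ Δ = Δ.lTensor A ∘ₗ Δ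

/-! A tensor `ξ` with `a ξ = ξ a` yields the bimodule map `a ↦ a ξ`, which is automatically
coassociative. Such tensors correspond to left module maps `φ` from the dual of `A` to `A`, and
injectivity means that `φ` has image with zero left annihilator. Self-injectivity makes `A` a
retract of `End K A`, a finite sum of copies of the dual, so finitely many maps `ψ i` have images
generating the unit ideal. Working modulo the Jacobson radical, one combination `∑ ψ i (·) * b i`
already does so. -/

/-- Over a semisimple ring, two families `u`, `v` can be combined to a single family of the form
`u + v b` which generates a two-sided ideal containing both of them. -/
theorem IsSemisimpleRing.exists_add_mul_generates {R X : Type*} [Ring R] [IsSemisimpleRing R]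
    (u v : X → R) :
    ∃ b : R, ∀ I : Ideal R, I.IsTwoSided → (∀ x, u x + v x * b ∈ I) →
      ∀ x, u x ∈ I ∧ v x ∈ I := by
  let T : Ideal R := sInf {I | I.IsTwoSided ∧ ∀ x, u x ∈ I}
  obtain ⟨e, he, hT⟩ := IsSemisimpleRing.ideal_eq_span_idempotent T
  have hu : ∀ x, u x * e = u x := fun x => by
    have hx : u x ∈ T := Submodule.mem_sInf.2 fun I hI => hI.2 x
    rw [hT, Ideal.mem_span_singleton'] at hx
    obtain ⟨a, ha⟩ := hx
    rw [← ha, mul_assoc, he.eq]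
  have heT : e ∈ T := hT ▸ Ideal.mem_span_singleton_self e
  -- As `T = R e`, `e` fixes each `u x` on the right while `1 - e` is killed by it, so multiplying
  -- by `e` recovers `u x`.
  refine ⟨1 - e, fun I hI h => ?_⟩
  have huI : ∀ x, u x ∈ I := fun x => by
    have hx := I.mul_mem_right e (h x)
    rwa [add_mul, mul_assoc, sub_mul, one_mul, he.eq, sub_self, mul_zero, add_zero, hu] at hx
  have heI : e ∈ I := Submodule.mem_sInf.1 heT I ⟨hI, huI⟩
  refine fun x => ⟨huI x, ?_⟩
  have hv : v x = (u x + v x * (1 - e)) - u x + v x * e := by noncomm_ring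
  rw [hv]
  exact I.add_mem (I.sub_mem (h x) (huI x)) (I.mul_mem_left _ heI)

theorem IsSemisimpleRing.exists_sum_mul_generates {R X ι : Type*} [Ring R] [IsSemisimpleRing R]
    (s : Finset ι) (u : ι → X → R) :
    ∃ b : ι → R, ∀ I : Ideal R, I.IsTwoSided → (∀ x, ∑ i ∈ s, u i x * b i ∈ I) →
      ∀ i ∈ s, ∀ x, u i x ∈ I := by
  classical
  induction s using Finset.induction_on with
  | empty => exact ⟨0, by simp⟩
  | insert j s hj ih =>
    obtain ⟨b, hb⟩ := ih
    obtain ⟨c, hc⟩ := exists_add_mul_generates (fun x => ∑ i ∈ s, u i x * b i) (u j)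
    refine ⟨Function.update b j c, fun I hI h => ?_⟩
    have key := hc I hI fun x => by
      have hx := h x
      rw [Finset.sum_insert hj, Function.update_self, add_comm] at hx
      rwa [Finset.sum_congr rfl fun i hi =>
        by rw [Function.update_of_ne (ne_of_mem_of_not_mem hi hj)]] at hx
    intro i hi x
    rcases Finset.mem_insert.1 hi with rfl | hi
    · exact (key x).2
    · exact hb I hI (fun x => (key x).1) i hi x

theorem Ring.eq_top_of_sup_jacobson_eq_top {A : Type*} [Ring A] {T : Ideal A}
    (h : T ⊔ Ring.jacobson A = ⊤) : T = ⊤ := by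
  by_contra hT
  obtain ⟨m, hm, hTm⟩ := Ideal.exists_le_maximal T hT
  exact hm.ne_top (top_le_iff.1 (h ▸ sup_le hTm (Ring.jacobson_le_of_isMaximal m)))

/-- The semisimple case lifts along the quotient by the Jacobson radical. -/
theorem IsSemiprimaryRing.exists_sum_mul_generates {A X ι : Type*} [Ring A] [IsSemiprimaryRing A]
    (s : Finset ι) (u : ι → X → A) (hu : ∀ I : Ideal A, I.IsTwoSided →
      (∀ i ∈ s, ∀ x, u i x ∈ I) → I = ⊤) :
    ∃ b : ι → A, ∀ I : Ideal A, I.IsTwoSided → (∀ x, ∑ i ∈ s, u i x * b i ∈ I) → I = ⊤ := by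
  let π := Ideal.Quotient.mk (Ring.jacobson A)
  have hπ : Function.Surjective π := Ideal.Quotient.mk_surjective
  obtain ⟨b, hb⟩ := IsSemisimpleRing.exists_sum_mul_generates s fun i x => π (u i x)
  choose c hc using fun i => hπ (b i)
  refine ⟨c, fun I hI h => Ring.eq_top_of_sup_jacobson_eq_top ?_⟩
  have hmap : (I.map π).IsTwoSided := inferInstance
  have key := hb (I.map π) hmap fun x => by
    have hx := Ideal.mem_map_of_mem π (h x)
    simpa only [map_sum, map_mul, hc] using hx
  have hcomap : (I.map π).comap π = I ⊔ Ring.jacobson A := by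
    rw [Ideal.comap_map_of_surjective π hπ]
    congr 1
    exact Ideal.mk_ker
  rw [← hcomap]
  exact hu _ inferInstance fun i hi x => Ideal.mem_comap.2 (key i hi x)

/-- The endomorphisms of the vector space `A`, regarded as a left `A`-module by precomposition
with right multiplications. -/
def PrecompEnd (K A : Type*) [Field K] [Ring A] [Algebra K A] : Type _ := A →ₗ[K] A

namespace PrecompEnd

variable {K A : Type*} [Field K] [Ring A] [Algebra K A]

instance : AddCommGroup (PrecompEnd K A) := inferInstanceAs (AddCommGroup (A →ₗ[K] A))

instance : Module A (PrecompEnd K A) where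
  smul a F := LinearMap.comp (F : A →ₗ[K] A) (LinearMap.mulRight K a)
  one_smul (F : A →ₗ[K] A) := LinearMap.ext fun y => congrArg F (mul_one y)
  mul_smul a b (F : A →ₗ[K] A) := LinearMap.ext fun y => congrArg F (mul_assoc y a b).symm
  smul_zero _ := rfl
  smul_add _ _ _ := rfl
  add_smul a b (F : A →ₗ[K] A) := LinearMap.ext fun y =>
    (congrArg F (mul_add y a b)).trans (map_add F _ _)
  zero_smul (F : A →ₗ[K] A) := LinearMap.ext fun y =>
    (congrArg F (mul_zero y)).trans (map_zero F)

end PrecompEnd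

/-- If `A` is left self-injective, then `A` is a retract of `End K A` as a left module. -/
theorem exists_retraction_end (K : Type*) {A : Type*} [Field K] [Ring A] [Algebra K A]
    (hA : Module.Injective A A) :
    ∃ ρ : (A →ₗ[K] A) →ₗ[K] A, ρ LinearMap.id = 1 ∧
      ∀ (a : A) (F : A →ₗ[K] A), ρ (F ∘ₗ LinearMap.mulRight K a) = a * ρ F := by
  let ι : A →ₗ[A] PrecompEnd K A :=
    { toFun := fun a => LinearMap.mulRight K a
      map_add' := fun a b => LinearMap.ext fun y => mul_add y a b
      map_smul' := fun a b =>
        LinearMap.ext (f := LinearMap.mulRight K (a * b)) fun y => (mul_assoc y a b).symm }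
  have hι : Function.Injective ι := fun a b h => by
    simpa using LinearMap.congr_fun (show LinearMap.mulRight K a = LinearMap.mulRight K b from h) 1
  obtain ⟨ρ, hρ⟩ := hA.out ι hι LinearMap.id
  have hsmul : ∀ (a : A) (F : A →ₗ[K] A),
      ρ (F ∘ₗ LinearMap.mulRight K a : A →ₗ[K] A) = a * ρ F :=
    fun a F => ρ.map_smul a (F : PrecompEnd K A)
  refine ⟨⟨⟨fun F => ρ F, fun F G => ρ.map_add F G⟩, fun k F => ?_⟩, ?_, hsmul⟩
  · have hk : k • F = F ∘ₗ LinearMap.mulRight K (algebraMap K A k) := LinearMap.ext fun y => by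
      simp [← Algebra.commutes, ← Algebra.smul_def]
    change ρ (k • F : A →ₗ[K] A) = k • ρ F
    rw [hk, hsmul, Algebra.smul_def]
  · have h1 : (LinearMap.id : A →ₗ[K] A) = LinearMap.mulRight K 1 :=
      LinearMap.ext fun y => (mul_one y).symm
    change ρ (LinearMap.id : A →ₗ[K] A) = 1
    rw [h1]
    exact hρ 1

/-- A left self-injective algebra `A` admits a morphism of left modules from the dual of the right
regular module to `A` whose image has zero left annihilator. -/
theorem exists_dual_hom_faithful (K : Type*) {A : Type*} [Field K] [Ring A] [Algebra K A]
    [FiniteDimensional K A] (hA : Module.Injective A A) :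
    ∃ φ : Module.Dual K A →ₗ[K] A,
      (∀ (a : A) (f : Module.Dual K A), φ (f ∘ₗ LinearMap.mulRight K a) = a * φ f) ∧
      ∀ a : A, (∀ f, a * φ f = 0) → a = 0 := by
  have : IsArtinianRing A := IsArtinianRing.of_finite K A
  obtain ⟨ρ, hρ1, hρ⟩ := exists_retraction_end K hA
  let e := Module.finBasis K A
  let ψ : Fin (Module.finrank K A) → Module.Dual K A →ₗ[K] A := fun i =>
    ρ ∘ₗ LinearMap.smulRightₗ.flip (e i)
  have hψ : ∀ i (a : A) (f : Module.Dual K A),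
      ψ i (f ∘ₗ LinearMap.mulRight K a) = a * ψ i f := fun i a f => hρ a (f.smulRight (e i))
  -- The identity of `A` is the sum of the rank-one maps `y ↦ e.coord i y • e i`.
  have hid : ∑ i, ψ i (e.coord i) = 1 := by
    rw [← hρ1]
    change ∑ i, ρ ((e.coord i).smulRight (e i)) = _
    rw [← map_sum]
    congr 1
    ext y
    simp [e.sum_repr]
  obtain ⟨b, hb⟩ := IsSemiprimaryRing.exists_sum_mul_generates Finset.univ (fun i f => ψ i f)
    fun I _ h => (Ideal.eq_top_iff_one I).2 (hid ▸ I.sum_mem fun i hi => h i hi _)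
  refine ⟨∑ i, LinearMap.mulRight K (b i) ∘ₗ ψ i, ?_, fun a ha => ?_⟩
  · intro a f
    simp [hψ, Finset.mul_sum, mul_assoc]
  -- `T = {t | a A t = 0}` is two-sided and contains the image of `φ`, which is stable under left
  -- multiplication.
  · let T : Ideal A :=
      { carrier := {t | ∀ c, a * (c * t) = 0}
        add_mem' := fun hs ht c => by rw [mul_add, mul_add, hs c, ht c, add_zero]
        zero_mem' := fun c => by simp
        smul_mem' := fun r t ht c => by rw [smul_eq_mul, ← mul_assoc c]; exact ht _ }
    have hT : T.IsTwoSided := ⟨fun r ht c => by rw [← mul_assoc, ← mul_assoc, mul_assoc a, ht c,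
      zero_mul]⟩
    have htop := hb T hT fun f c => by
      have := ha (f ∘ₗ LinearMap.mulRight K c)
      simpa [hψ, Finset.mul_sum, mul_assoc] using this
    have h1 : (1 : A) ∈ T := htop ▸ Submodule.mem_top
    simpa using h1 1

/-- Left multiplication of elements of `A` on the left tensor factor of a fixed tensor. -/
def comulOfTensor {K A : Type*} [Field K] [Ring A] [Algebra K A] (ξ : A ⊗[K] A) :
    A →ₗ[K] A ⊗[K] A :=
  (LinearMap.rTensorHom A).flip ξ ∘ₗ LinearMap.mul K A

theorem comulOfTensor_apply {K A : Type*} [Field K] [Ring A] [Algebra K A] (ξ : A ⊗[K] A)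
    (a : A) : comulOfTensor ξ a = (LinearMap.mulLeft K a).rTensor A ξ := rfl

theorem comulOfTensor_isBimoduleComul {K A : Type*} [Field K] [Ring A] [Algebra K A]
    {ξ : A ⊗[K] A}
    (hξ : ∀ a, (LinearMap.mulLeft K a).rTensor A ξ = (LinearMap.mulRight K a).lTensor A ξ) :
    IsBimoduleComul (comulOfTensor ξ) := by
  have hl : ∀ a b : A,
      comulOfTensor ξ (a * b) = (LinearMap.mulLeft K a).rTensor A (comulOfTensor ξ b) := by
    intro a b
    simp only [comulOfTensor_apply]
    rw [← LinearMap.comp_apply, ← LinearMap.rTensor_comp, LinearMap.mulLeft_mul]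
  refine ⟨hl, fun b a => ?_⟩
  rw [hl, comulOfTensor_apply ξ a, hξ, comulOfTensor_apply, ← LinearMap.comp_apply,
    ← LinearMap.comp_apply, LinearMap.rTensor_comp_lTensor, LinearMap.lTensor_comp_rTensor]

theorem comulOfTensor_add {K A : Type*} [Field K] [Ring A] [Algebra K A] (s t : A ⊗[K] A) :
    comulOfTensor (s + t) = comulOfTensor s + comulOfTensor t :=
  LinearMap.ext fun a => map_add ((LinearMap.mulLeft K a).rTensor A) s t

theorem assoc_lTensor_mulRight_tmul {K A : Type*} [Field K] [Ring A] [Algebra K A]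
    (s : A ⊗[K] A) (x y : A) :
    TensorProduct.assoc K A A A ((LinearMap.mulRight K x).lTensor A s ⊗ₜ y) =
      (comulOfTensor (x ⊗ₜ y)).lTensor A s := by
  induction s using TensorProduct.induction_on with
  | zero => simp
  | tmul p q => simp [comulOfTensor_apply]
  | add s t hs ht => simp only [map_add, TensorProduct.add_tmul, hs, ht]

/-- Since `Δ x = ξ x`, applying `Δ ⊗ id` to any `t` is the same as applying `id ⊗ (a ↦ a t)` to `ξ`.
For `t = b ξ` this is `(id ⊗ Δ)(ξ b)`, and `ξ b = b ξ`. -/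
theorem comulOfTensor_isCoassociative {K A : Type*} [Field K] [Ring A] [Algebra K A]
    {ξ : A ⊗[K] A}
    (hξ : ∀ a, (LinearMap.mulLeft K a).rTensor A ξ = (LinearMap.mulRight K a).lTensor A ξ) :
    IsCoassociative (comulOfTensor ξ) := by
  have key : ∀ t : A ⊗[K] A, TensorProduct.assoc K A A A ((comulOfTensor ξ).rTensor A t) =
      (comulOfTensor t).lTensor A ξ := by
    intro t
    induction t using TensorProduct.induction_on with
    | zero => simp [comulOfTensor]
    | tmul x y =>
      rw [LinearMap.rTensor_tmul, comulOfTensor_apply, hξ, assoc_lTensor_mulRight_tmul]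
    | add s t hs ht =>
      rw [map_add, map_add, hs, ht, comulOfTensor_add, LinearMap.lTensor_add, LinearMap.add_apply]
  have hcomp : ∀ b, comulOfTensor (comulOfTensor ξ b) =
      comulOfTensor ξ ∘ₗ LinearMap.mulRight K b := fun b => LinearMap.ext fun a =>
    ((comulOfTensor_isBimoduleComul hξ).1 a b).symm
  refine LinearMap.ext fun b => (key _).trans ?_
  rw [hcomp, LinearMap.lTensor_comp, LinearMap.comp_apply, ← hξ]
  rfl

theorem mainTheorem1 (K : Type*) [Field K] (A : Type*) [Ring A] [Algebra K A]
    [FiniteDimensional K A] (hA : IsSelfInjective A) :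
    ∃ Δ : A →ₗ[K] A ⊗[K] A,
      Function.Injective Δ ∧ IsCoassociative Δ ∧ IsBimoduleComul Δ := by
  obtain ⟨φ, hφ, hfaith⟩ := exists_dual_hom_faithful K hA.1
  let e := Module.finBasis K A
  let ξ : A ⊗[K] A := ∑ i, φ (e.coord i) ⊗ₜ e i
  have hslice : ∀ f : Module.Dual K A, TensorProduct.rid K A (f.lTensor A ξ) = φ f := by
    intro f
    have hf : ∑ i, f (e i) • e.coord i = f := e.ext fun j => by simp
    refine Eq.trans ?_ (congrArg φ hf)
    simp only [ξ, map_sum, map_smul, LinearMap.lTensor_tmul, TensorProduct.rid_tmul]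
  have hslice_l : ∀ (a : A) (f : Module.Dual K A), TensorProduct.rid K A
      (f.lTensor A ((LinearMap.mulLeft K a).rTensor A ξ)) = a * φ f := by
    intro a f
    rw [← hslice f]
    simp [ξ, Finset.mul_sum]
  have hcasimir : ∀ a,
      (LinearMap.mulLeft K a).rTensor A ξ = (LinearMap.mulRight K a).lTensor A ξ := by
    intro a
    -- Slicing the right factor by the dual basis separates tensors; the slices agree by left
    -- linearity of `φ`.
    apply (TensorProduct.equivFinsuppOfBasisRight (M := A) e).injective
    ext i
    rw [TensorProduct.equivFinsuppOfBasisRight_apply, TensorProduct.equivFinsuppOfBasisRight_apply,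
      hslice_l, ← LinearMap.comp_apply, ← LinearMap.lTensor_comp, hslice, hφ]
  refine ⟨comulOfTensor ξ, ?_, comulOfTensor_isCoassociative hcasimir,
    comulOfTensor_isBimoduleComul hcasimir⟩
  rw [injective_iff_map_eq_zero]
  intro a ha
  refine hfaith a fun f => ?_
  rw [← hslice_l, ← comulOfTensor_apply, ha]
  simp
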